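/- Let $N\ge 1$, let $X_1,\dots,X_N\in\mathbb R^d$ with empirical measure $\widehat{\mathbb P}=\frac1N\sum_{i=1}^N\delta_{X_i}$, let $M$ be a real symmetric positive definite $d\times d$ matrix, let $\rho\ge 0$, $\epsilon\ge 0$ and $\beta\in\mathbb R^d$, and write $\|x\|_A=\sqrt{x^\top A x}$. Let $\ell:\mathbb R\to\mathbb R$ be a convex quadratic loss, i.e. $\ell''\equiv\gamma$ for a constant $\gamma>0$. Consider the perturbed martingale distributionally robust loss with the linear feature map $x\mapsto\beta^\top x$, $$\mathcal L_\beta(\widehat{\mathbb P},\rho,\epsilon)=\sup_{\pi}\ \mathbb E_\pi[\ell(\beta^\top\bar X)],$$ where $\pi$ ranges over the probability distributions of pairs $(\bar X,X)$ on $\mathbb R^d\times\mathbb R^d$ such that $X$ has law $\widehat{\mathbb P}$, $\mathbb E_\pi[(X-\bar X)^\top M(X-\bar X)]\le\rho$, and $\|\mathbb E_\pi[\bar X\mid X]-X\|_M\le\epsilon$ almost surely (for every such $\pi$, the random variables $\bar X$ and $\ell(\beta^\top\bar X)$ are integrable). Then $$\mathcal L_\beta(\widehat{\mathbb P},\rho,\epsilon)=\mathbb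 E_{\widehat{\mathbb P}}[\ell(\beta^\top X)]+\frac{\gamma\rho}{2}\|\beta\|_{M^{-1}}^2+R(\beta),\qquad R(\beta)=\|\beta\|_{M^{-1}}\min_{s\in\mathbb R^N}\Big(\frac{\epsilon}{N}\|s\|_1+\sqrt{\frac{\rho}{N}}\,\|G_\beta-s\|_2\Big),$$ where $G_\beta=(\ell'(\beta^\top X_1),\dots,\ell'(\beta^\top X_N))^\top$ and the minimum is attained. The model interpolates between two regimes: (a) if $\epsilon=0$, then $R(\beta)=0$, so that $\mathcal L_\beta(\widehat{\mathbb P},\rho,0)=\mathbb E_{\widehat{\mathbb P}}[\ell(\beta^\top X)]+\frac{\gamma\rho}{2}\|\beta\|_{M^{-1}}^2$ (Tikhonov regularization); (b) if $\epsilon^2\ge N\rho$, then $R(\beta)=\sqrt{\rho\,\mathbb E_{\widehat{\mathbb P}}\big[\|\ell'(\beta^\top X)\beta\|_{M^{-1}}^2\big]}$ and, with $m=\min_{t\in\mathbb R}\ell(t)$, $\mathcal L_\beta(\widehat{\mathbb P},\rho,\epsilon)=m+\Big(\sqrt{\mathbb E_{\widehat{\mathbb P}}[\ell(\beta^\top X)]-m}+\sqrt{\tfrac{\gamma\rho}{2}}\,\|\beta\|_{M^{-1}}\Big)^2$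 (square-root regularized regression). -/

import Mathlib

open MeasureTheory
open scoped Matrix

noncomputable section

/-- The norm `‖x‖_A = √(xᵀ A x)` of a positive definite matrix `A`. -/
def mahalanobisNorm {d : ℕ} (A : Matrix (Fin d) (Fin d) ℝ) (x : Fin d → ℝ) : ℝ :=
  √(x ⬝ᵥ A *ᵥ x)

/-- The Mahalanobis ground cost `c(x̄, x) = (x - x̄)ᵀ M (x - x̄)`. -/
def mahalanobisCost {d : ℕ} (M : Matrix (Fin d) (Fin d) ℝ) (xbar x : Fin d → ℝ) : ℝ :=
  (x - xbar) ⬝ᵥ M *ᵥ (x - xbar)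

/-- The empirical measure `P̂ = N⁻¹ ∑ᵢ δ_{Xᵢ}` of a sample `X₁, …, X_N`. -/
def empiricalMeasure {N d : ℕ} (X : Fin N → Fin d → ℝ) : Measure (Fin d → ℝ) :=
  (N : ENNReal)⁻¹ • ∑ i, Measure.dirac (X i)

/-- The adversary's feasible couplings `π` of `(X̄, X)` (first coordinate `X̄`, second `X`):
probability measures with second marginal `P̂`, with `E_π[c(X̄, X)] ≤ ρ` (the expectation of the
nonnegative cost being finite), and with `‖E_π[X̄ | X] - X‖_M ≤ ε` almost surely, where `E_π[· | X]`
is the conditional expectation given the `σ`-algebra generated by the second coordinate. -/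
def perturbedMartingaleCouplings {N d : ℕ} (M : Matrix (Fin d) (Fin d) ℝ)
    (X : Fin N → Fin d → ℝ) (ρ ε : ℝ) : Set (Measure ((Fin d → ℝ) × (Fin d → ℝ))) :=
  {π | IsProbabilityMeasure π ∧
    π.map Prod.snd = empiricalMeasure X ∧
    Integrable (fun p => mahalanobisCost M p.1 p.2) π ∧
    ∫ p, mahalanobisCost M p.1 p.2 ∂π ≤ ρ ∧
    ∀ᵐ p ∂π, mahalanobisNorm M
      ((π[Prod.fst | MeasurableSpace.comap Prod.snd inferInstance]) p - p.2) ≤ ε}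

/-- The value `𝓛_β(P̂, ρ, ε)` of the perturbed martingale DRO model for the loss `ℓ` and the
feature mapping `f = f_β`: the supremum of `E_π[ℓ(f(X̄))]` over the feasible couplings. -/
def perturbedMartingaleDRO {N d : ℕ} (M : Matrix (Fin d) (Fin d) ℝ) (X : Fin N → Fin d → ℝ)
    (ℓ : ℝ → ℝ) (f : (Fin d → ℝ) → ℝ) (ρ ε : ℝ) : EReal :=
  ⨆ π ∈ perturbedMartingaleCouplings M X ρ ε, ((∫ p, ℓ (f p.1) ∂π : ℝ) : EReal)

/-- The vector `G_β = (ℓ'(βᵀX₁), …, ℓ'(βᵀX_N))`. -/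
def gradVec {N d : ℕ} (X : Fin N → Fin d → ℝ) (ℓ : ℝ → ℝ) (β : Fin d → ℝ) : Fin N → ℝ :=
  fun i => deriv ℓ (β ⬝ᵥ X i)

/-- The objective `(ε / N) ‖s‖₁ + √(ρ / N) ‖G - s‖₂` of the minimization over `s ∈ ℝ^N`. -/
def regularizerObjective {N : ℕ} (G : Fin N → ℝ) (ρ ε : ℝ) (s : Fin N → ℝ) : ℝ :=
  ε / N * ∑ i, |s i| + √(ρ / N) * √(∑ i, (G i - s i) ^ 2)

/-- The regularizer `R(β) = ‖β‖_{M⁻¹} min_s ((ε / N) ‖s‖₁ + √(ρ / N) ‖G_β - s‖₂)`. -/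
def regularizer {N d : ℕ} (M : Matrix (Fin d) (Fin d) ℝ) (X : Fin N → Fin d → ℝ)
    (ℓ : ℝ → ℝ) (ρ ε : ℝ) (β : Fin d → ℝ) : ℝ :=
  mahalanobisNorm M⁻¹ β * ⨅ s : Fin N → ℝ, regularizerObjective (gradVec X ℓ β) ρ ε s

end

/-! Write `n = ‖β‖_{M⁻¹}` and `Δ = βᵀ(X̄ - X)`. A quadratic loss is exactly `ℓ(βᵀX) + ℓ'(βᵀX) Δ +
(γ/2) Δ²`. Cauchy–Schwarz and the budget give `E[Δ²] ≤ n²ρ`, hence the Tikhonov term. The linear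
term sees only `D(X) = E[Δ | X]`, which satisfies `|D| ≤ nε` on the sample and `∑ D(Xᵢ)² ≤ N n² ρ`.
Maximizing `⟨D, G⟩` over this sup-norm ball cut by a Euclidean ball is dual to the infimal
convolution in `R` (`exists_dual_optimal`); weak duality gives the upper bound `integral_loss_le`.

Both bounds are attained together: move each sample point along `M⁻¹β / n` by the dual optimal
amount and spend the remaining budget on a symmetric spread `± τ`, which leaves the conditional mean
unchanged (`spreadCoupling_mem`). The regimes correspond to the minimizers `s = G` and `s = 0`; in
the second, `ℓ'² = 2γ(ℓ - m)` completes the square. -/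

/-! ### Exact second-order expansion of the loss -/

section Quadratic

variable {ℓ : ℝ → ℝ} {γ : ℝ}

theorem deriv_eq_add_of_deriv_deriv_eq (hℓ : ContDiff ℝ 2 ℓ) (hℓγ : ∀ t, deriv (deriv ℓ) t = γ)
    (a t : ℝ) : deriv ℓ t = deriv ℓ a + γ * (t - a) := by
  have hd : Differentiable ℝ (deriv ℓ) :=
    (((contDiff_succ_iff_deriv (n := 1)).1 hℓ).2.2).differentiable (by norm_num)
  have hder : ∀ x, HasDerivAt (fun x => deriv ℓ x - γ * x) 0 x := fun x => by
    have h := (hd x).hasDerivAt.sub ((hasDerivAt_id x).const_mul γ)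
    exact h.congr_deriv (by rw [hℓγ]; ring)
  have := is_const_of_deriv_eq_zero (fun x => (hder x).differentiableAt)
    (fun x => (hder x).deriv) t a
  linarith

theorem quadratic_expansion (hℓ : ContDiff ℝ 2 ℓ) (hℓγ : ∀ t, deriv (deriv ℓ) t = γ)
    (a t : ℝ) : ℓ t = ℓ a + deriv ℓ a * (t - a) + γ / 2 * (t - a) ^ 2 := by
  have hder : ∀ x, HasDerivAt
      (fun x => ℓ x - (deriv ℓ a * (x - a) + γ / 2 * (x - a) ^ 2)) 0 x := fun x => by
    have h1 := (hℓ.differentiable (by norm_num) x).hasDerivAt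
    have h2 := (hasDerivAt_id x).sub_const a
    have h := h1.sub ((h2.const_mul (deriv ℓ a)).add ((h2.pow 2).const_mul (γ / 2)))
    refine h.congr_deriv ?_
    rw [deriv_eq_add_of_deriv_deriv_eq hℓ hℓγ a x]
    simp
    ring
  have := is_const_of_deriv_eq_zero (fun x => (hder x).differentiableAt)
    (fun x => (hder x).deriv) t a
  linarith [this, sub_self a, show deriv ℓ a * (a - a) + γ / 2 * (a - a) ^ 2 = 0 by ring]

/-- Converts the squared gradient in `R` into excess loss, for the square-root regime. -/
theorem deriv_sq_of_isLeast (hℓ : ContDiff ℝ 2 ℓ)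
    (hℓγ : ∀ t, deriv (deriv ℓ) t = γ) {m : ℝ} (hm : IsLeast (Set.range ℓ) m) (t : ℝ) :
    deriv ℓ t ^ 2 = 2 * γ * (ℓ t - m) := by
  obtain ⟨⟨a, rfl⟩, hmin⟩ := hm
  have h0 : deriv ℓ a = 0 :=
    IsLocalMin.deriv_eq_zero (Filter.Eventually.of_forall fun x => hmin ⟨x, rfl⟩)
  rw [quadratic_expansion hℓ hℓγ a t, deriv_eq_add_of_deriv_deriv_eq hℓ hℓγ a t, h0]
  ring

end Quadratic

/-! ### Dual pair of Mahalanobis norms -/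

section Mahalanobis

variable {d : ℕ} {A M : Matrix (Fin d) (Fin d) ℝ}

theorem mahalanobisNorm_nonneg (A : Matrix (Fin d) (Fin d) ℝ) (x : Fin d → ℝ) :
    0 ≤ mahalanobisNorm A x := Real.sqrt_nonneg _

theorem Matrix.PosDef.quadForm_nonneg (hA : A.PosDef) (x : Fin d → ℝ) : 0 ≤ x ⬝ᵥ A *ᵥ x := by
  simpa using hA.posSemidef.dotProduct_mulVec_nonneg x

theorem sq_mahalanobisNorm (hA : A.PosDef) (x : Fin d → ℝ) :
    mahalanobisNorm A x ^ 2 = x ⬝ᵥ A *ᵥ x :=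
  Real.sq_sqrt (hA.quadForm_nonneg x)

theorem mahalanobisNorm_smul (A : Matrix (Fin d) (Fin d) ℝ) (c : ℝ) (x : Fin d → ℝ) :
    mahalanobisNorm A (c • x) = |c| * mahalanobisNorm A x := by
  unfold mahalanobisNorm
  rw [Matrix.mulVec_smul, smul_dotProduct, dotProduct_smul, smul_smul, smul_eq_mul,
    Real.sqrt_mul (mul_self_nonneg c), Real.sqrt_mul_self_eq_abs]

theorem mulVec_inv_mulVec (hM : M.PosDef) (x : Fin d → ℝ) : M *ᵥ (M⁻¹ *ᵥ x) = x := by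
  rw [Matrix.mulVec_mulVec, Matrix.mul_nonsing_inv _ ((Matrix.isUnit_iff_isUnit_det _).1 hM.isUnit),
    Matrix.one_mulVec]

theorem dotProduct_mulVec_comm_of_posDef (hM : M.PosDef) (x y : Fin d → ℝ) :
    x ⬝ᵥ M *ᵥ y = y ⬝ᵥ M *ᵥ x := by
  have h : Mᵀ = M := by simpa using hM.isHermitian.eq
  rw [Matrix.dotProduct_mulVec, ← Matrix.mulVec_transpose, h, dotProduct_comm]

/-- Cauchy–Schwarz, from the discriminant of the nonnegative quadratic form of `M` at `x + t M⁻¹ b`.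
-/
theorem dotProduct_sq_le (hM : M.PosDef) (b x : Fin d → ℝ) :
    (b ⬝ᵥ x) ^ 2 ≤ mahalanobisNorm M⁻¹ b ^ 2 * (x ⬝ᵥ M *ᵥ x) := by
  rw [sq_mahalanobisNorm hM.inv]
  have h : ∀ t : ℝ, 0 ≤ (b ⬝ᵥ M⁻¹ *ᵥ b) * (t * t) + (2 * (b ⬝ᵥ x)) * t + x ⬝ᵥ M *ᵥ x := by
    intro t
    have h0 := hM.quadForm_nonneg (x + t • (M⁻¹ *ᵥ b))
    rw [Matrix.mulVec_add, Matrix.mulVec_smul, mulVec_inv_mulVec hM, add_dotProduct,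
      dotProduct_add, dotProduct_add, smul_dotProduct, smul_dotProduct, dotProduct_smul,
      dotProduct_smul, dotProduct_mulVec_comm_of_posDef hM (M⁻¹ *ᵥ b) x, mulVec_inv_mulVec hM,
      dotProduct_comm (M⁻¹ *ᵥ b) b, dotProduct_comm x b] at h0
    simp only [smul_eq_mul] at h0
    linarith
  have := discrim_le_zero h
  unfold discrim at this
  linarith

theorem abs_dotProduct_le (hM : M.PosDef) (b x : Fin d → ℝ) :
    |b ⬝ᵥ x| ≤ mahalanobisNorm M⁻¹ b * mahalanobisNorm M x := by
  refine abs_le_of_sq_le_sq ?_ (mul_nonneg (mahalanobisNorm_nonneg _ _) (mahalanobisNorm_nonneg _ _))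
  rw [mul_pow, sq_mahalanobisNorm hM]
  exact dotProduct_sq_le hM b x

/-- The direction `M⁻¹ β / ‖β‖_{M⁻¹}`, dual to `β`. -/
noncomputable def dualDirection (M : Matrix (Fin d) (Fin d) ℝ) (β : Fin d → ℝ) : Fin d → ℝ :=
  (mahalanobisNorm M⁻¹ β)⁻¹ • (M⁻¹ *ᵥ β)

theorem dotProduct_dualDirection (hM : M.PosDef) (β : Fin d → ℝ) :
    β ⬝ᵥ dualDirection M β = mahalanobisNorm M⁻¹ β := by
  rw [dualDirection, dotProduct_smul, ← sq_mahalanobisNorm hM.inv, smul_eq_mul]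
  rcases eq_or_ne (mahalanobisNorm M⁻¹ β) 0 with h | h
  · simp [h]
  · field_simp

/-- Equality can fail only when the norm of `β` is `0`: then `0⁻¹ = 0` makes the direction zero. -/
theorem dualDirection_quadForm_le (hM : M.PosDef) (β : Fin d → ℝ) :
    dualDirection M β ⬝ᵥ M *ᵥ dualDirection M β ≤ 1 := by
  rw [dualDirection, Matrix.mulVec_smul, mulVec_inv_mulVec hM, smul_dotProduct, dotProduct_smul,
    dotProduct_comm, ← sq_mahalanobisNorm hM.inv, smul_eq_mul, smul_eq_mul]
  rcases eq_or_ne (mahalanobisNorm M⁻¹ β) 0 with h | h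
  · simp [h]
  · field_simp
    exact le_rfl

end Mahalanobis

/-! ### Duality for a sup-norm ball cut by a Euclidean ball -/

section Duality

variable {ι : Type*} [Fintype ι]

/-- Weak duality: split `g = s + (g - s)`, with Hölder on `s` and Cauchy–Schwarz on `g - s`. -/
theorem sum_mul_le_of_abs_le_of_sum_sq_le {g u s : ι → ℝ} {ε r : ℝ} (hr : 0 ≤ r)
    (hu : ∀ i, |u i| ≤ ε) (hu2 : ∑ i, u i ^ 2 ≤ r ^ 2) :
    ∑ i, u i * g i ≤ ε * ∑ i, |s i| + r * √(∑ i, (g i - s i) ^ 2) := by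
  have h1 : ∑ i, u i * s i ≤ ε * ∑ i, |s i| := by
    rw [Finset.mul_sum]
    refine Finset.sum_le_sum fun i _ => (le_abs_self _).trans ?_
    rw [abs_mul]
    exact mul_le_mul_of_nonneg_right (hu i) (abs_nonneg _)
  have h2 : ∑ i, u i * (g i - s i) ≤ r * √(∑ i, (g i - s i) ^ 2) := by
    refine (Real.sum_mul_le_sqrt_mul_sqrt _ _ _).trans
      (mul_le_mul_of_nonneg_right ?_ (Real.sqrt_nonneg _))
    exact Real.sqrt_le_iff.2 ⟨hr, hu2⟩
  have h3 : ∑ i, u i * g i = ∑ i, u i * s i + ∑ i, u i * (g i - s i) := by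
    rw [← Finset.sum_add_distrib]
    exact Finset.sum_congr rfl fun i _ => by ring
  linarith

/-- Strong duality between the maximization of `⟨u, g⟩` over an intersection of a sup-norm ball with
a Euclidean ball and the infimal convolution of the dual norms; the maximizer can be taken to be a
function of the entries of `g`. -/
theorem exists_dual_optimal (g : ι → ℝ) {ε r : ℝ} (hε : 0 ≤ ε) (hr : 0 ≤ r) :
    ∃ (h : ℝ → ℝ) (s : ι → ℝ), Measurable h ∧ (∀ t, |h t| ≤ ε) ∧ ∑ i, h (g i) ^ 2 ≤ r ^ 2 ∧
      ∑ i, h (g i) * g i = ε * ∑ i, |s i| + r * √(∑ i, (g i - s i) ^ 2) := by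
  rcases hr.eq_or_lt with rfl | hr
  · exact ⟨fun _ => 0, fun _ => 0, measurable_const, by simpa using hε, by simp, by simp⟩
  -- If `ε · sign g` lies in the Euclidean ball, only the sup-norm constraint matters and `s = g`.
  -- Zero entries are left out, since clipping multiples of `g` never moves them.
  by_cases hbig : ∑ i, (if g i = 0 then (0 : ℝ) else ε) ^ 2 ≤ r ^ 2
  · refine ⟨fun t => if t = 0 then 0 else if 0 < t then ε else -ε, g, ?_, ?_, ?_, ?_⟩
    · exact Measurable.ite (measurableSet_singleton 0) measurable_const
        (Measurable.ite measurableSet_Ioi measurable_const measurable_const)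
    · intro t
      dsimp only
      split_ifs <;> simp [abs_of_nonneg hε, hε]
    · refine le_trans (le_of_eq (Finset.sum_congr rfl fun i _ => ?_)) hbig
      by_cases h : g i = 0
      · simp [h]
      · by_cases h' : 0 < g i <;> simp [h, h']
    · simp only [sub_self, ne_eq, OfNat.ofNat_ne_zero, not_false_eq_true, zero_pow,
        Finset.sum_const_zero, Real.sqrt_zero, mul_zero, add_zero, Finset.mul_sum]
      refine Finset.sum_congr rfl fun i _ => ?_
      split_ifs with h1 h2
      · simp [h1]
      · rw [abs_of_pos h2]
      · rw [abs_of_nonpos (not_lt.1 h2)]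
        ring
  push Not at hbig
  have hclip : ∀ t, |max (-ε) (min ε t)| ≤ ε := fun t =>
    abs_le.2 ⟨le_max_left _ _, max_le (by linarith) (min_le_left _ _)⟩
  -- Otherwise the maximizer is `c * g` clipped to `[-ε, ε]`, with `c` chosen by the intermediate
  -- value theorem to make the Euclidean constraint tight.
  let φ : ℝ → ℝ := fun c => ∑ i, max (-ε) (min ε (c * g i)) ^ 2
  have hφ : Continuous φ := by fun_prop
  have hφ0 : φ 0 = 0 := by simp [φ, hε]
  obtain ⟨C, hC, hφC⟩ : ∃ C, 0 ≤ C ∧ r ^ 2 ≤ φ C := by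
    -- This scale saturates every nonzero entry; zero entries contribute `ε / 0 = 0`.
    refine ⟨∑ i, ε / |g i|, Finset.sum_nonneg fun i _ => by positivity, hbig.le.trans ?_⟩
    refine Finset.sum_le_sum fun i _ => ?_
    split_ifs with h
    · rw [zero_pow two_ne_zero]
      exact sq_nonneg _
    have hle : ε / |g i| ≤ ∑ i, ε / |g i| :=
      Finset.single_le_sum (f := fun i => ε / |g i|) (fun i _ => by positivity) (Finset.mem_univ i)
    rw [div_le_iff₀ (abs_pos.2 h)] at hle
    rcases lt_or_gt_of_ne h with h | h
    · rw [abs_of_neg h] at hle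
      rw [min_eq_right (by linarith), max_eq_left (by linarith), neg_sq]
    · rw [abs_of_pos h] at hle
      rw [min_eq_left hle, max_eq_right (by linarith)]
  obtain ⟨c, ⟨hc0, -⟩, hc⟩ := intermediate_value_Icc hC hφ.continuousOn
    ⟨hφ0.le.trans (sq_nonneg r), hφC⟩
  have hcpos : 0 < c := by
    refine hc0.lt_of_ne ?_
    rintro rfl
    rw [hφ0] at hc
    exact absurd hc (by positivity)
  set u : ι → ℝ := fun i => max (-ε) (min ε (c * g i)) with hu
  -- Complementary slackness: `g - s = u / c` is parallel to `u`, while `s` vanishes at unclipped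
  -- entries and otherwise has the sign of `u` or is zero. Both inequalities of weak duality become
  -- equalities.
  refine ⟨fun t => max (-ε) (min ε (c * t)), fun i => g i - u i / c, by fun_prop,
    fun t => hclip _, hc.le, ?_⟩
  have hsq : ∑ i, (g i - (g i - u i / c)) ^ 2 = (r / c) ^ 2 := by
    rw [div_pow, ← hc, Finset.sum_div]
    exact Finset.sum_congr rfl fun i _ => by ring
  have hs : ∀ i, u i * (g i - u i / c) = ε * |g i - u i / c| := by
    intro i
    rcases le_total (c * g i) (-ε) with h | h
    · have hui : u i = -ε := by
        simp only [hu]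
        rw [min_eq_right (by linarith), max_eq_left h]
      have : g i - u i / c ≤ 0 := by
        rw [hui, sub_nonpos, le_div_iff₀ hcpos]
        linarith
      rw [abs_of_nonpos this, hui]
      ring
    rcases le_total ε (c * g i) with h' | h'
    · have hui : u i = ε := by
        simp only [hu]
        rw [min_eq_left h', max_eq_right (by linarith)]
      have : 0 ≤ g i - u i / c := by
        rw [hui, sub_nonneg, div_le_iff₀ hcpos]
        linarith
      rw [abs_of_nonneg this, hui]
    · have hui : u i = c * g i := by
        simp only [hu]
        rw [min_eq_right h', max_eq_right h]
      have : g i - u i / c = 0 := by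
        rw [hui]
        field_simp
        ring
      simp [this]
  rw [hsq, Real.sqrt_sq (by positivity), Finset.mul_sum]
  have h3 : ∑ i, u i * g i = ∑ i, u i * (g i - u i / c) + (∑ i, u i ^ 2) / c := by
    rw [Finset.sum_div, ← Finset.sum_add_distrib]
    exact Finset.sum_congr rfl fun i _ => by ring
  have hc' : ∑ i, u i ^ 2 = r ^ 2 := hc
  change ∑ i, u i * g i = _
  rw [h3, hc', Finset.sum_congr rfl fun i _ => hs i]
  ring

end Duality

/-! ### Integration against the empirical measure -/

section Empirical

variable {N d : ℕ} {E : Type*} [NormedAddCommGroup E]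

theorem isProbabilityMeasure_empiricalMeasure (hN : 0 < N) (X : Fin N → Fin d → ℝ) :
    IsProbabilityMeasure (empiricalMeasure X) := by
  constructor
  have h : (N : ENNReal) ≠ 0 := by exact_mod_cast hN.ne'
  simp [empiricalMeasure, ENNReal.inv_mul_cancel h (ENNReal.natCast_ne_top N)]

theorem integrable_empiricalMeasure (hN : 0 < N) (X : Fin N → Fin d → ℝ)
    (f : (Fin d → ℝ) → E) : Integrable f (empiricalMeasure X) := by
  have h : (N : ENNReal) ≠ 0 := by exact_mod_cast hN.ne'
  refine Integrable.smul_measure ?_ (ENNReal.inv_ne_top.2 h)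
  exact integrable_finsetSum_measure.2 fun i _ => integrable_dirac enorm_lt_top

theorem integral_empiricalMeasure [NormedSpace ℝ E] [CompleteSpace E] (X : Fin N → Fin d → ℝ)
    (f : (Fin d → ℝ) → E) : ∫ x, f x ∂(empiricalMeasure X) = (N : ℝ)⁻¹ • ∑ i, f (X i) := by
  rw [empiricalMeasure, integral_smul_measure,
    integral_finsetSum_measure fun i _ => integrable_dirac enorm_lt_top]
  simp

theorem forall_of_ae_empiricalMeasure {X : Fin N → Fin d → ℝ} {p : (Fin d → ℝ) → Prop}
    (h : ∀ᵐ x ∂(empiricalMeasure X), p x) (i : Fin N) : p (X i) := by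
  rw [empiricalMeasure, Measure.ae_ennreal_smul_measure_iff (by simp)] at h
  have h' : ∀ᵐ x ∂(Measure.dirac (X i)), p x :=
    Measure.absolutelyContinuous_of_le
      (Finset.single_le_sum (f := fun i => Measure.dirac (X i)) (fun _ _ => Measure.zero_le _)
        (Finset.mem_univ i)) h
  rwa [ae_dirac_eq] at h'

end Empirical

/-- Links the Euclidean radius of the unnormalized dual problem to the coefficient in
`regularizerObjective`. -/
theorem sqrt_mul_div_natCast {N : ℕ} (hN : 0 < N) (ρ : ℝ) : √(N * ρ) / N = √(ρ / N) := by
  have hN' : (0 : ℝ) < N := by exact_mod_cast hN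
  rw [div_eq_iff hN'.ne', ← Real.sqrt_sq hN'.le, ← Real.sqrt_mul' _ (sq_nonneg _),
    Real.sqrt_sq hN'.le]
  congr 1
  field_simp

/-! ### Feasible couplings and their conditional displacement -/

section Coupling

variable {N d : ℕ} {M : Matrix (Fin d) (Fin d) ℝ} {X : Fin N → Fin d → ℝ} {ρ ε : ℝ}
  {π : Measure ((Fin d → ℝ) × (Fin d → ℝ))}

theorem integrable_comp_snd {E : Type*} [NormedAddCommGroup E] (hN : 0 < N)
    (hπ : π.map Prod.snd = empiricalMeasure X) (f : (Fin d → ℝ) → E) :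
    Integrable (fun p => f p.2) π := by
  have h := integrable_empiricalMeasure hN X f
  rw [← hπ] at h
  exact h.comp_measurable measurable_snd

theorem integral_comp_snd {E : Type*} [NormedAddCommGroup E] [NormedSpace ℝ E] [CompleteSpace E]
    (hN : 0 < N) (hπ : π.map Prod.snd = empiricalMeasure X) (f : (Fin d → ℝ) → E) :
    ∫ p, f p.2 ∂π = (N : ℝ)⁻¹ • ∑ i, f (X i) := by
  rw [← integral_empiricalMeasure, ← hπ, integral_map measurable_snd.aemeasurable]
  rw [hπ]
  exact (integrable_empiricalMeasure hN X f).aestronglyMeasurable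

theorem measurable_dotProduct_fst_sub_snd (b : Fin d → ℝ) :
    Measurable fun p : (Fin d → ℝ) × (Fin d → ℝ) => b ⬝ᵥ (p.1 - p.2) := by
  unfold dotProduct
  fun_prop

theorem sq_dotProduct_le_mahalanobisCost (hM : M.PosDef) (b : Fin d → ℝ)
    (p : (Fin d → ℝ) × (Fin d → ℝ)) :
    (b ⬝ᵥ (p.1 - p.2)) ^ 2 ≤ mahalanobisNorm M⁻¹ b ^ 2 * mahalanobisCost M p.1 p.2 := by
  have h := dotProduct_sq_le hM b (p.2 - p.1)
  rwa [← neg_sub p.1 p.2, dotProduct_neg, neg_sq, neg_sub] at h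

theorem memLp_two_dotProduct (hM : M.PosDef)
    (hc : Integrable (fun p => mahalanobisCost M p.1 p.2) π) (b : Fin d → ℝ) :
    MemLp (fun p => b ⬝ᵥ (p.1 - p.2)) 2 π := by
  have hmeas := measurable_dotProduct_fst_sub_snd b
  rw [memLp_two_iff_integrable_sq hmeas.aestronglyMeasurable]
  refine (hc.const_mul (mahalanobisNorm M⁻¹ b ^ 2)).mono'
    (hmeas.pow_const 2).aestronglyMeasurable (Filter.Eventually.of_forall fun p => ?_)
  rw [Real.norm_of_nonneg (sq_nonneg _)]
  exact sq_dotProduct_le_mahalanobisCost hM b p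

theorem integrable_dotProduct_fst [IsFiniteMeasure π] (hN : 0 < N) (hM : M.PosDef)
    (hπ : π.map Prod.snd = empiricalMeasure X)
    (hc : Integrable (fun p => mahalanobisCost M p.1 p.2) π) (b : Fin d → ℝ) :
    Integrable (fun p => b ⬝ᵥ p.1) π := by
  have h := ((memLp_two_dotProduct hM hc b).integrable one_le_two).add
    (integrable_comp_snd hN hπ fun x => b ⬝ᵥ x)
  refine h.congr (Filter.Eventually.of_forall fun p => ?_)
  simp [dotProduct_sub]

theorem integrable_fst [IsFiniteMeasure π] (hN : 0 < N) (hM : M.PosDef)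
    (hπ : π.map Prod.snd = empiricalMeasure X)
    (hc : Integrable (fun p => mahalanobisCost M p.1 p.2) π) : Integrable Prod.fst π := by
  refine Integrable.of_eval fun i => ?_
  simpa using integrable_dotProduct_fst hN hM hπ hc (Pi.single i 1)

theorem memLp_two_comp_snd (hN : 0 < N)
    (hπ : π.map Prod.snd = empiricalMeasure X) (g : (Fin d → ℝ) → ℝ) :
    MemLp (fun p => g p.2) 2 π := by
  rw [memLp_two_iff_integrable_sq (integrable_comp_snd hN hπ g).aestronglyMeasurable]
  exact integrable_comp_snd hN hπ fun x => g x ^ 2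

/-- Under a coupling, the conditional mean displacement `D` of `β ⬝ᵥ X̄` is a function on the sample
through which displacements can be averaged. -/
theorem exists_conditional_displacement (hN : 0 < N) (hM : M.PosDef)
    (hπ : π ∈ perturbedMartingaleCouplings M X ρ ε) (β : Fin d → ℝ) :
    ∃ D : (Fin d → ℝ) → ℝ, Measurable D ∧
      (∀ i, |D (X i)| ≤ mahalanobisNorm M⁻¹ β * ε) ∧
      ∀ k : (Fin d → ℝ) → ℝ, Measurable k →
        ∫ p, k p.2 * (β ⬝ᵥ (p.1 - p.2)) ∂π = ∫ p, k p.2 * D p.2 ∂π := by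
  obtain ⟨hprob, hsnd, hc, -, hε⟩ := hπ
  have hle : MeasurableSpace.comap (Prod.snd : (Fin d → ℝ) × (Fin d → ℝ) → _) inferInstance ≤
      (inferInstance : MeasurableSpace ((Fin d → ℝ) × (Fin d → ℝ))) := measurable_snd.comap_le
  -- Doob–Dynkin: the conditional mean factors as `H` of the second coordinate.
  obtain ⟨H, hH, hHeq⟩ := (stronglyMeasurable_condExp (μ := π) (f := Prod.fst)
    (m := MeasurableSpace.comap (Prod.snd : (Fin d → ℝ) × (Fin d → ℝ) → _)
      inferInstance)).exists_eq_measurable_comp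
  have hdot : Measurable fun x : Fin d → ℝ => β ⬝ᵥ x := by
    unfold dotProduct
    fun_prop
  rw [hHeq] at hε
  refine ⟨fun x => β ⬝ᵥ (H x - x), hdot.comp (hH.measurable.sub measurable_id), fun i => ?_,
    fun k hk => ?_⟩
  · have hae : ∀ᵐ x ∂(empiricalMeasure X), mahalanobisNorm M (H x - x) ≤ ε := by
      rw [← hsnd]
      refine (ae_map_iff measurable_snd.aemeasurable ?_).2 hε
      refine measurableSet_le ?_ measurable_const
      have hH' := hH.measurable
      unfold mahalanobisNorm dotProduct Matrix.mulVec dotProduct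
      fun_prop
    exact (abs_dotProduct_le hM _ _).trans (mul_le_mul_of_nonneg_left
      (forall_of_ae_empiricalMeasure hae i) (mahalanobisNorm_nonneg _ _))
  let T : (Fin d → ℝ) →L[ℝ] ℝ := LinearMap.toContinuousLinearMap (dotProductBilin ℝ ℝ β)
  have hfst := integrable_fst hN hM hsnd hc
  have hkm : StronglyMeasurable[MeasurableSpace.comap Prod.snd inferInstance]
      (fun p : (Fin d → ℝ) × (Fin d → ℝ) => k p.2) :=
    hk.stronglyMeasurable.comp_measurable (comap_measurable _)
  have hint : Integrable ((fun p => k p.2) * fun p => β ⬝ᵥ p.1) π := by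
    have h := ((memLp_two_comp_snd hN hsnd k).integrable_mul (memLp_two_dotProduct hM hc β)).add
      (integrable_comp_snd hN hsnd fun x => k x * (β ⬝ᵥ x))
    refine h.congr (Filter.Eventually.of_forall fun p => ?_)
    simp [dotProduct_sub]
    ring
  have hβfst := integrable_dotProduct_fst hN hM hsnd hc β
  have h1 := T.comp_condExp_comm (m := MeasurableSpace.comap Prod.snd inferInstance) hfst
  have h2 := condExp_mul_of_stronglyMeasurable_left hkm hint hβfst
  -- The tower property, pulling out both the factor `k` and the linear functional `β ⬝ᵥ ·`.
  have h3 : ∫ p, k p.2 * (β ⬝ᵥ p.1) ∂π = ∫ p, k p.2 * (β ⬝ᵥ H p.2) ∂π := by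
    rw [show (fun p : (Fin d → ℝ) × (Fin d → ℝ) => k p.2 * (β ⬝ᵥ p.1)) =
      (fun p => k p.2) * fun p => β ⬝ᵥ p.1 from rfl]
    rw [← integral_condExp hle]
    refine integral_congr_ae ?_
    rw [hHeq] at h1
    filter_upwards [h1, h2] with p hp1 hp2
    rw [hp2, Pi.mul_apply]
    exact congrArg (k p.2 * ·) hp1.symm
  simp only [dotProduct_sub, mul_sub]
  have hint' : Integrable (fun p : (Fin d → ℝ) × (Fin d → ℝ) => k p.2 * (β ⬝ᵥ p.1)) π := hint
  rw [integral_sub hint' (integrable_comp_snd hN hsnd fun x => k x * (β ⬝ᵥ x)),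
    integral_sub (integrable_comp_snd hN hsnd fun x => k x * (β ⬝ᵥ H x))
      (integrable_comp_snd hN hsnd fun x => k x * (β ⬝ᵥ x))]
  exact congrArg (· - _) h3

/-- Testing the averaging identity with `k = D` replaces conditional Jensen: `E[D²] = E[DΔ] ≤ ½E[D²]
+ ½E[Δ²]`, so `E[D²] ≤ E[Δ²]`. -/
theorem sum_sq_displacement_le (hN : 0 < N) (hM : M.PosDef)
    (hπ : π ∈ perturbedMartingaleCouplings M X ρ ε) {β : Fin d → ℝ} {D : (Fin d → ℝ) → ℝ}
    (hD : ∫ p, D p.2 * (β ⬝ᵥ (p.1 - p.2)) ∂π = ∫ p, D p.2 * D p.2 ∂π) :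
    ∑ i, D (X i) ^ 2 ≤ N * (mahalanobisNorm M⁻¹ β ^ 2 * ρ) := by
  have hN' : (0 : ℝ) < N := by exact_mod_cast hN
  obtain ⟨hprob, hsnd, hc, hρ, -⟩ := hπ
  have hle : ∫ p, D p.2 * (β ⬝ᵥ (p.1 - p.2)) ∂π ≤
      ∫ p, (1 / 2 * (D p.2 * D p.2) +
        1 / 2 * (mahalanobisNorm M⁻¹ β ^ 2 * mahalanobisCost M p.1 p.2)) ∂π := by
    refine integral_mono
      ((memLp_two_comp_snd hN hsnd D).integrable_mul (memLp_two_dotProduct hM hc β))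
      (((integrable_comp_snd hN hsnd fun x => D x * D x).const_mul _).add
        ((hc.const_mul _).const_mul _)) fun p => ?_
    have h1 := sq_dotProduct_le_mahalanobisCost hM β p
    have h2 := two_mul_le_add_sq (D p.2) (β ⬝ᵥ (p.1 - p.2))
    dsimp only
    linarith
  rw [integral_add ((integrable_comp_snd hN hsnd fun x => D x * D x).const_mul _)
    ((hc.const_mul _).const_mul _), integral_const_mul, integral_const_mul, integral_const_mul,
    hD, integral_comp_snd hN hsnd fun x => D x * D x, smul_eq_mul] at hle
  have h3 := mul_le_mul_of_nonneg_left hρ (sq_nonneg (mahalanobisNorm M⁻¹ β))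
  have h4 : (N : ℝ)⁻¹ * ∑ i, D (X i) * D (X i) ≤ mahalanobisNorm M⁻¹ β ^ 2 * ρ := by linarith
  rw [inv_mul_le_iff₀ hN'] at h4
  simpa only [sq] using h4

end Coupling

/-! ### Upper bound on the worst-case loss -/

section Loss

variable {N d : ℕ} {M : Matrix (Fin d) (Fin d) ℝ} {X : Fin N → Fin d → ℝ} {ρ ε : ℝ}
  {π : Measure ((Fin d → ℝ) × (Fin d → ℝ))} {ℓ : ℝ → ℝ} {γ : ℝ}

theorem loss_expansion (hℓ : ContDiff ℝ 2 ℓ) (hℓγ : ∀ t, deriv (deriv ℓ) t = γ) (β : Fin d → ℝ)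
    (p : (Fin d → ℝ) × (Fin d → ℝ)) :
    ℓ (β ⬝ᵥ p.1) = ℓ (β ⬝ᵥ p.2) + deriv ℓ (β ⬝ᵥ p.2) * (β ⬝ᵥ (p.1 - p.2)) +
      γ / 2 * (β ⬝ᵥ (p.1 - p.2)) ^ 2 := by
  rw [dotProduct_sub]
  exact quadratic_expansion hℓ hℓγ _ _

theorem integrable_loss_terms (hN : 0 < N) (hM : M.PosDef)
    (hπ : π ∈ perturbedMartingaleCouplings M X ρ ε) (β : Fin d → ℝ) (g : (Fin d → ℝ) → ℝ) :
    Integrable (fun p => g p.2 * (β ⬝ᵥ (p.1 - p.2))) π ∧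
      Integrable (fun p => γ / 2 * (β ⬝ᵥ (p.1 - p.2)) ^ 2) π := by
  obtain ⟨hprob, hsnd, hc, -, -⟩ := hπ
  have h := memLp_two_dotProduct hM hc β
  exact ⟨(memLp_two_comp_snd hN hsnd g).integrable_mul h, h.integrable_sq.const_mul _⟩

theorem integrable_loss (hN : 0 < N) (hM : M.PosDef)
    (hπ : π ∈ perturbedMartingaleCouplings M X ρ ε) (hℓ : ContDiff ℝ 2 ℓ)
    (hℓγ : ∀ t, deriv (deriv ℓ) t = γ) (β : Fin d → ℝ) :
    Integrable (fun p => ℓ (β ⬝ᵥ p.1)) π := by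
  obtain ⟨h1, h2⟩ :=
    integrable_loss_terms (γ := γ) hN hM hπ β fun x => deriv ℓ (β ⬝ᵥ x)
  simp only [loss_expansion hℓ hℓγ]
  exact ((integrable_comp_snd hN hπ.2.1 fun x => ℓ (β ⬝ᵥ x)).add h1).add h2

theorem integral_loss_le (hN : 0 < N) (hM : M.PosDef) (hρ : 0 ≤ ρ)
    (hπ : π ∈ perturbedMartingaleCouplings M X ρ ε) (hγ : 0 ≤ γ) (hℓ : ContDiff ℝ 2 ℓ)
    (hℓγ : ∀ t, deriv (deriv ℓ) t = γ) (β : Fin d → ℝ) (s : Fin N → ℝ) :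
    ∫ p, ℓ (β ⬝ᵥ p.1) ∂π ≤ ∫ x, ℓ (β ⬝ᵥ x) ∂(empiricalMeasure X) +
      γ * ρ * mahalanobisNorm M⁻¹ β ^ 2 / 2 +
      mahalanobisNorm M⁻¹ β * regularizerObjective (gradVec X ℓ β) ρ ε s := by
  have hN' : (0 : ℝ) < N := by exact_mod_cast hN
  obtain ⟨h1, h2⟩ :=
    integrable_loss_terms (γ := γ) hN hM hπ β fun x => deriv ℓ (β ⬝ᵥ x)
  obtain ⟨D, hDm, hDε, hD⟩ := exists_conditional_displacement hN hM hπ β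
  have hD2 := sum_sq_displacement_le hN hM hπ (hD D hDm)
  obtain ⟨hprob, hsnd, hc, hcρ, -⟩ := hπ
  have hg : Measurable fun x : Fin d → ℝ => deriv ℓ (β ⬝ᵥ x) := by
    refine (measurable_deriv ℓ).comp ?_
    unfold dotProduct
    fun_prop
  set n := mahalanobisNorm M⁻¹ β with hn
  have hn0 : 0 ≤ n := mahalanobisNorm_nonneg _ _
  simp only [loss_expansion hℓ hℓγ]
  have h0 : Integrable (fun p : (Fin d → ℝ) × (Fin d → ℝ) =>
      ℓ (β ⬝ᵥ p.2) + deriv ℓ (β ⬝ᵥ p.2) * (β ⬝ᵥ (p.1 - p.2))) π :=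
    (integrable_comp_snd hN hsnd fun x => ℓ (β ⬝ᵥ x)).add h1
  rw [integral_add h0 h2,
    integral_add (integrable_comp_snd hN hsnd fun x => ℓ (β ⬝ᵥ x)) h1,
    hD (fun x => deriv ℓ (β ⬝ᵥ x)) hg, integral_comp_snd hN hsnd fun x => ℓ (β ⬝ᵥ x),
    integral_comp_snd hN hsnd fun x => deriv ℓ (β ⬝ᵥ x) * D x, integral_empiricalMeasure]
  have h3 : ∫ p, γ / 2 * (β ⬝ᵥ (p.1 - p.2)) ^ 2 ∂π ≤ γ / 2 * (n ^ 2 * ρ) := by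
    rw [integral_const_mul]
    refine mul_le_mul_of_nonneg_left ?_ (by positivity)
    calc _ ≤ ∫ p, n ^ 2 * mahalanobisCost M p.1 p.2 ∂π :=
          integral_mono (memLp_two_dotProduct hM hc β).integrable_sq (hc.const_mul _)
            fun p => sq_dotProduct_le_mahalanobisCost hM β p
      _ ≤ _ := by
          rw [integral_const_mul]
          exact mul_le_mul_of_nonneg_left hcρ (sq_nonneg _)
  -- Both constraints on `D` are scaled by `n`, so `n` factors out of the dual bound.
  have hr : (N : ℝ) * (n ^ 2 * ρ) = (n * √(N * ρ)) ^ 2 := by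
    rw [mul_pow, Real.sq_sqrt (by positivity)]
    ring
  rw [hr] at hD2
  have h4 := sum_mul_le_of_abs_le_of_sum_sq_le (g := gradVec X ℓ β) (s := s) (by positivity) hDε hD2
  have h5 : (N : ℝ)⁻¹ • ∑ i, deriv ℓ (β ⬝ᵥ X i) * D (X i) ≤
      n * regularizerObjective (gradVec X ℓ β) ρ ε s := by
    rw [smul_eq_mul, inv_mul_le_iff₀ hN']
    refine (le_of_eq (Finset.sum_congr rfl fun i _ => mul_comm _ _)).trans (h4.trans (le_of_eq ?_))
    rw [regularizerObjective, ← sqrt_mul_div_natCast hN]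
    field_simp
  linarith

end Loss

/-! ### The extremal coupling -/

section SpreadCoupling

variable {N d : ℕ} {E : Type*} [NormedAddCommGroup E]

/-- The coupling that moves each sample point `x` to `x + (D x ± τ) v` with equal probabilities. -/
noncomputable def spreadCoupling (X : Fin N → Fin d → ℝ) (D : (Fin d → ℝ) → ℝ) (τ : ℝ)
    (v : Fin d → ℝ) : Measure ((Fin d → ℝ) × (Fin d → ℝ)) :=
  (N : ENNReal)⁻¹ • ∑ i, (2 : ENNReal)⁻¹ • (Measure.dirac (X i + (D (X i) + τ) • v, X i) +
    Measure.dirac (X i + (D (X i) - τ) • v, X i))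

variable (X : Fin N → Fin d → ℝ) (D : (Fin d → ℝ) → ℝ) (τ : ℝ) (v : Fin d → ℝ)

theorem map_snd_spreadCoupling : (spreadCoupling X D τ v).map Prod.snd = empiricalMeasure X := by
  rw [spreadCoupling, empiricalMeasure, Measure.map_smul, ← Measure.mapₗ_apply_of_measurable
    measurable_snd, map_sum]
  congr 1
  refine Finset.sum_congr rfl fun i _ => ?_
  rw [Measure.mapₗ_apply_of_measurable measurable_snd, Measure.map_smul,
    Measure.map_add _ _ measurable_snd, Measure.map_dirac' measurable_snd,
    Measure.map_dirac' measurable_snd, ← two_smul ENNReal, smul_smul,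
    ENNReal.inv_mul_cancel two_ne_zero ENNReal.ofNat_ne_top, one_smul]

theorem isProbabilityMeasure_spreadCoupling (hN : 0 < N) :
    IsProbabilityMeasure (spreadCoupling X D τ v) := by
  have := isProbabilityMeasure_empiricalMeasure hN X
  constructor
  rw [← Set.preimage_univ (f := Prod.snd), ← Measure.map_apply measurable_snd .univ,
    map_snd_spreadCoupling, measure_univ]

theorem integrable_spreadCoupling_term (f : (Fin d → ℝ) × (Fin d → ℝ) → E) (i : Fin N) :
    Integrable f ((2 : ENNReal)⁻¹ • (Measure.dirac (X i + (D (X i) + τ) • v, X i) +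
      Measure.dirac (X i + (D (X i) - τ) • v, X i))) :=
  ((integrable_dirac enorm_lt_top).add_measure (integrable_dirac enorm_lt_top)).smul_measure
    (by simp)

theorem integrable_spreadCoupling (hN : 0 < N) (f : (Fin d → ℝ) × (Fin d → ℝ) → E) :
    Integrable f (spreadCoupling X D τ v) := by
  have h : (N : ENNReal) ≠ 0 := by exact_mod_cast hN.ne'
  refine Integrable.smul_measure ?_ (ENNReal.inv_ne_top.2 h)
  exact integrable_finsetSum_measure.2 fun i _ => integrable_spreadCoupling_term X D τ v f i

theorem integral_spreadCoupling [NormedSpace ℝ E] [CompleteSpace E]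
    (f : (Fin d → ℝ) × (Fin d → ℝ) → E) :
    ∫ p, f p ∂(spreadCoupling X D τ v) = (N : ℝ)⁻¹ • ∑ i, (2 : ℝ)⁻¹ •
      (f (X i + (D (X i) + τ) • v, X i) + f (X i + (D (X i) - τ) • v, X i)) := by
  rw [spreadCoupling, integral_smul_measure,
    integral_finsetSum_measure fun i _ => integrable_spreadCoupling_term X D τ v f i]
  rw [ENNReal.toReal_inv, ENNReal.toReal_natCast]
  congr 1
  refine Finset.sum_congr rfl fun i _ => ?_
  rw [integral_smul_measure, integral_add_measure (integrable_dirac enorm_lt_top)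
    (integrable_dirac enorm_lt_top), integral_dirac, integral_dirac, ENNReal.toReal_inv,
    ENNReal.toReal_ofNat]

/-- The shifts `± τ` cancel at each sample point. Because `D` depends on the point and not on its
index, repeated sample points cause no conflict. -/
theorem condExp_fst_spreadCoupling (hN : 0 < N) (hD : Measurable D) :
    (fun p => p.2 + D p.2 • v) =ᵐ[spreadCoupling X D τ v]
      (spreadCoupling X D τ v)[Prod.fst | MeasurableSpace.comap Prod.snd inferInstance] := by
  have := isProbabilityMeasure_spreadCoupling X D τ v hN
  refine ae_eq_condExp_of_forall_setIntegral_eq measurable_snd.comap_le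
    (integrable_spreadCoupling X D τ v hN _)
    (fun _ _ _ => (integrable_spreadCoupling X D τ v hN _).integrableOn) ?_ ?_
  · rintro _ ⟨t, ht, rfl⟩ -
    rw [← integral_indicator (measurable_snd ht), ← integral_indicator (measurable_snd ht),
      integral_spreadCoupling, integral_spreadCoupling]
    congr 1
    refine Finset.sum_congr rfl fun i _ => ?_
    by_cases hi : X i ∈ t
    · simp only [Set.indicator, Set.mem_preimage, hi, if_true]
      module
    · simp [Set.indicator, hi]
  · refine StronglyMeasurable.aestronglyMeasurable ?_
    have h : Measurable fun x : Fin d → ℝ => x + D x • v := by fun_prop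
    exact h.stronglyMeasurable.comp_measurable (comap_measurable _)

variable {X D τ v} {M : Matrix (Fin d) (Fin d) ℝ} {ρ ε : ℝ}

theorem spreadCoupling_mem (hN : 0 < N) (hD : Measurable D) (hv : v ⬝ᵥ M *ᵥ v ≤ 1)
    (hε : ∀ x, |D x| ≤ ε) (hρ : (N : ℝ)⁻¹ * ∑ i, D (X i) ^ 2 + τ ^ 2 ≤ ρ) :
    spreadCoupling X D τ v ∈ perturbedMartingaleCouplings M X ρ ε := by
  have hN' : (0 : ℝ) < N := by exact_mod_cast hN
  refine ⟨isProbabilityMeasure_spreadCoupling X D τ v hN, map_snd_spreadCoupling X D τ v,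
    integrable_spreadCoupling X D τ v hN _, ?_, ?_⟩
  · have hcost : ∀ (x : Fin d → ℝ) (c : ℝ),
        mahalanobisCost M (x + c • v) x = c ^ 2 * (v ⬝ᵥ M *ᵥ v) := fun x c => by
      have hx : x - (x + c • v) = (-c) • v := by module
      rw [mahalanobisCost, hx, Matrix.mulVec_smul, smul_dotProduct, dotProduct_smul, smul_eq_mul,
        smul_eq_mul]
      ring
    rw [integral_spreadCoupling]
    refine le_trans ?_ hρ
    have hsum : (N : ℝ)⁻¹ * ∑ i, D (X i) ^ 2 + τ ^ 2 =
        (N : ℝ)⁻¹ * ∑ i : Fin N, (D (X i) ^ 2 + τ ^ 2) := by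
      rw [Finset.sum_add_distrib, Finset.sum_const, Finset.card_univ, Fintype.card_fin,
        nsmul_eq_mul]
      field_simp
    rw [hsum, smul_eq_mul]
    refine mul_le_mul_of_nonneg_left (Finset.sum_le_sum fun i _ => ?_) (by positivity)
    simp only [hcost, smul_eq_mul]
    have := mul_le_mul_of_nonneg_left hv (add_nonneg (sq_nonneg (D (X i))) (sq_nonneg τ))
    linarith
  · filter_upwards [condExp_fst_spreadCoupling X D τ v hN hD] with p hp
    rw [← hp, add_sub_cancel_left, mahalanobisNorm_smul]
    refine (mul_le_of_le_one_right (abs_nonneg _) ?_).trans (hε p.2)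
    exact Real.sqrt_le_one.2 hv

/-- Averaging the two branches leaves `D` in the linear term and `D² + τ²` in the quadratic one, so
`τ` affects only the latter. -/
theorem integral_loss_spreadCoupling (hN : 0 < N) {ℓ : ℝ → ℝ} {γ : ℝ} (hℓ : ContDiff ℝ 2 ℓ)
    (hℓγ : ∀ t, deriv (deriv ℓ) t = γ) (β : Fin d → ℝ) :
    ∫ p, ℓ (β ⬝ᵥ p.1) ∂(spreadCoupling X D τ v) = ∫ x, ℓ (β ⬝ᵥ x) ∂(empiricalMeasure X) +
      γ * ((N : ℝ)⁻¹ * ∑ i, D (X i) ^ 2 + τ ^ 2) * (β ⬝ᵥ v) ^ 2 / 2 +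
      (β ⬝ᵥ v) * ((N : ℝ)⁻¹ * ∑ i, D (X i) * gradVec X ℓ β i) := by
  have hN' : (0 : ℝ) < N := by exact_mod_cast hN
  have hterm : ∀ i, (2 : ℝ)⁻¹ • (ℓ (β ⬝ᵥ (X i + (D (X i) + τ) • v)) +
      ℓ (β ⬝ᵥ (X i + (D (X i) - τ) • v))) = ℓ (β ⬝ᵥ X i) +
        γ / 2 * (β ⬝ᵥ v) ^ 2 * D (X i) ^ 2 + γ / 2 * (β ⬝ᵥ v) ^ 2 * τ ^ 2 +
        (β ⬝ᵥ v) * (D (X i) * gradVec X ℓ β i) := fun i => by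
    rw [quadratic_expansion hℓ hℓγ (β ⬝ᵥ X i), quadratic_expansion hℓ hℓγ (β ⬝ᵥ X i)
      (β ⬝ᵥ (X i + (D (X i) - τ) • v)), gradVec]
    simp only [dotProduct_add, dotProduct_smul, smul_eq_mul]
    ring
  rw [integral_spreadCoupling, integral_empiricalMeasure]
  simp only [hterm, Finset.sum_add_distrib, ← Finset.mul_sum, Finset.sum_const, Finset.card_univ,
    Fintype.card_fin, nsmul_eq_mul, smul_eq_mul]
  field_simp
  ring

end SpreadCoupling

/-! ### Minimizers of the regularizer objective -/

section Regularizer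

variable {N d : ℕ} {ρ ε : ℝ}

theorem regularizerObjective_nonneg (G : Fin N → ℝ) (hε : 0 ≤ ε) (s : Fin N → ℝ) :
    0 ≤ regularizerObjective G ρ ε s := by
  unfold regularizerObjective
  have := Finset.sum_nonneg fun i (_ : i ∈ Finset.univ) => abs_nonneg (s i)
  positivity

theorem iInf_eq_of_isMinOn {α : Type*} {f : α → ℝ} {s : α} (h : IsMinOn f Set.univ s) :
    ⨅ x, f x = f s :=
  (show IsLeast (Set.range f) (f s) from ⟨⟨s, rfl⟩, by
    rintro _ ⟨x, rfl⟩
    exact h (Set.mem_univ x)⟩).csInf_eq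

theorem isMinOn_regularizerObjective_of_eps_eq_zero (G : Fin N → ℝ) (ρ : ℝ) :
    IsMinOn (regularizerObjective G ρ 0) Set.univ G := fun s _ => by
  have h := regularizerObjective_nonneg (ρ := ρ) G le_rfl s
  simpa [regularizerObjective] using h

theorem isMinOn_regularizerObjective_zero (hN : 0 < N) (G : Fin N → ℝ) (hε : 0 ≤ ε)
    (h : N * ρ ≤ ε ^ 2) : IsMinOn (regularizerObjective G ρ ε) Set.univ 0 := fun s _ => by
  have hN' : (0 : ℝ) < N := by exact_mod_cast hN
  have hobj : ∀ s, regularizerObjective G ρ ε s =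
      (ε * ∑ i, |s i| + √(N * ρ) * √(∑ i, (G i - s i) ^ 2)) / N := fun s => by
    rw [regularizerObjective, ← sqrt_mul_div_natCast hN]
    ring
  have hr : √(N * ρ) ≤ ε := Real.sqrt_le_iff.2 ⟨hε, h⟩
  have hr0 := Real.sqrt_nonneg (N * ρ)
  set r := √(N * ρ)
  set n := √(∑ i, G i ^ 2) with hn
  have hn2 : ∑ i, G i ^ 2 = n ^ 2 :=
    (Real.sq_sqrt (Finset.sum_nonneg fun i _ => sq_nonneg (G i))).symm
  have hn0 : 0 ≤ n := Real.sqrt_nonneg _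
  have hG : ∀ i, |G i| ≤ n := fun i => by
    rw [hn, ← Real.sqrt_sq_eq_abs]
    exact Real.sqrt_le_sqrt (Finset.single_le_sum (f := fun i => G i ^ 2)
      (fun i _ => sq_nonneg (G i)) (Finset.mem_univ i))
  -- The certificate `r G / ‖G‖₂` maximizes over the Euclidean ball, which lies in the sup-norm ball
  -- because `r ≤ ε`. For `G = 0` it is `0` by the convention for division.
  have hdual := sum_mul_le_of_abs_le_of_sum_sq_le (g := G) (s := s) (ε := ε)
    (u := fun i => r * (G i / n)) hr0 (fun i => ?_) ?_
  · have hval : ∑ i, r * (G i / n) * G i = r * n := by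
      rw [show ∑ i, r * (G i / n) * G i = r * ((∑ i, G i ^ 2) / n) by
        rw [Finset.sum_div, Finset.mul_sum]
        exact Finset.sum_congr rfl fun i _ => by ring, hn2, sq, mul_self_div_self]
    rw [hval] at hdual
    rw [Set.mem_ofPred_eq, hobj, hobj]
    refine div_le_div_of_nonneg_right ?_ hN'.le
    simpa [← hn] using hdual
  · rw [abs_mul, abs_div, abs_of_nonneg hr0, abs_of_nonneg hn0]
    exact (mul_le_of_le_one_right hr0 (div_le_one_of_le₀ (hG i) hn0)).trans hr
  · rw [show ∑ i, (r * (G i / n)) ^ 2 = r ^ 2 * ((∑ i, G i ^ 2) / n ^ 2) by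
      rw [Finset.sum_div, Finset.mul_sum]
      exact Finset.sum_congr rfl fun i _ => by ring, hn2]
    exact mul_le_of_le_one_right (sq_nonneg r) (div_self_le_one _)

/-- The regularizer objective has a minimizer at which strong duality holds. -/
theorem exists_isMinOn_regularizerObjective (hN : 0 < N) (G : Fin N → ℝ) (hρ : 0 ≤ ρ)
    (hε : 0 ≤ ε) :
    ∃ (h : ℝ → ℝ) (s : Fin N → ℝ), Measurable h ∧ (∀ t, |h t| ≤ ε) ∧
      (N : ℝ)⁻¹ * ∑ i, h (G i) ^ 2 ≤ ρ ∧
      (N : ℝ)⁻¹ * ∑ i, h (G i) * G i = regularizerObjective G ρ ε s ∧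
      IsMinOn (regularizerObjective G ρ ε) Set.univ s := by
  have hN' : (0 : ℝ) < N := by exact_mod_cast hN
  obtain ⟨h, s, hm, hle, hsq, heq⟩ := exists_dual_optimal G hε (Real.sqrt_nonneg (N * ρ))
  have hobj : ∀ s, regularizerObjective G ρ ε s =
      (N : ℝ)⁻¹ * (ε * ∑ i, |s i| + √(N * ρ) * √(∑ i, (G i - s i) ^ 2)) := fun s => by
    rw [regularizerObjective, ← sqrt_mul_div_natCast hN]
    ring
  refine ⟨h, s, hm, hle, ?_, ?_, fun t _ => ?_⟩
  · rw [Real.sq_sqrt (by positivity)] at hsq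
    rwa [inv_mul_le_iff₀ hN']
  · rw [hobj, heq]
  · rw [Set.mem_ofPred_eq, hobj, hobj, ← heq]
    refine mul_le_mul_of_nonneg_left ?_ (by positivity)
    exact sum_mul_le_of_abs_le_of_sum_sq_le (Real.sqrt_nonneg _) (fun i => hle _) hsq

end Regularizer

/-! ### The worst-case value and its two regimes -/

section Value

variable {N d : ℕ} {M : Matrix (Fin d) (Fin d) ℝ} {ρ ε γ : ℝ} {ℓ : ℝ → ℝ}

/-- The worst-case loss is the empirical loss plus a Tikhonov term and the regularizer. -/
theorem perturbedMartingaleDRO_eq (hN : 0 < N) (hM : M.PosDef) (X : Fin N → Fin d → ℝ)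
    (hρ : 0 ≤ ρ) (hε : 0 ≤ ε) (hγ : 0 ≤ γ) (hℓ : ContDiff ℝ 2 ℓ)
    (hℓγ : ∀ t, deriv (deriv ℓ) t = γ) (β : Fin d → ℝ) :
    perturbedMartingaleDRO M X ℓ (fun x => β ⬝ᵥ x) ρ ε =
      ((∫ x, ℓ (β ⬝ᵥ x) ∂(empiricalMeasure X) + γ * ρ * mahalanobisNorm M⁻¹ β ^ 2 / 2 +
        regularizer M X ℓ ρ ε β : ℝ) : EReal) := by
  obtain ⟨h, s, hm, hle, hsq, heq, hmin⟩ :=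
    exists_isMinOn_regularizerObjective hN (gradVec X ℓ β) hρ hε
  rw [regularizer, iInf_eq_of_isMinOn hmin]
  refine le_antisymm (iSup₂_le fun π hπ => EReal.coe_le_coe_iff.2
    (integral_loss_le hN hM hρ hπ hγ hℓ hℓγ β s)) ?_
  -- Since the dual optimum is `h` of the entries of `G`, it extends to a measurable displacement on
  -- all of `ℝ^d`.
  have hD : Measurable fun x : Fin d → ℝ => h (deriv ℓ (β ⬝ᵥ x)) := by
    refine hm.comp ((measurable_deriv ℓ).comp ?_)
    unfold dotProduct
    fun_prop
  have hτ := Real.sq_sqrt (sub_nonneg.2 hsq)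
  -- The spread uses up exactly the transport budget left by the displacement.
  set τ := √(ρ - (N : ℝ)⁻¹ * ∑ i, h (gradVec X ℓ β i) ^ 2)
  have hτ' : (N : ℝ)⁻¹ * ∑ i, h (gradVec X ℓ β i) ^ 2 + τ ^ 2 = ρ := by
    rw [hτ]
    ring
  refine le_iSup₂_of_le _ (spreadCoupling_mem (X := X) (τ := τ) hN hD
    (dualDirection_quadForm_le hM β) (fun x => hle _) hτ'.le) (EReal.coe_le_coe_iff.2 (le_of_eq ?_))
  rw [integral_loss_spreadCoupling hN hℓ hℓγ, dotProduct_dualDirection hM]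
  change _ = _ + γ * ((N : ℝ)⁻¹ * ∑ i, h (gradVec X ℓ β i) ^ 2 + τ ^ 2) * _ / 2 +
    _ * ((N : ℝ)⁻¹ * ∑ i, h (gradVec X ℓ β i) * gradVec X ℓ β i)
  rw [hτ', heq]

theorem regularizer_eq_zero (X : Fin N → Fin d → ℝ) (ρ : ℝ) (ℓ : ℝ → ℝ) (β : Fin d → ℝ) :
    regularizer M X ℓ ρ 0 β = 0 := by
  rw [regularizer, iInf_eq_of_isMinOn (isMinOn_regularizerObjective_of_eps_eq_zero _ ρ)]
  simp [regularizerObjective]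

theorem regularizer_eq_mul_sqrt (hN : 0 < N) (X : Fin N → Fin d → ℝ) (hρ : 0 ≤ ρ) (hε : 0 ≤ ε)
    (h : N * ρ ≤ ε ^ 2) (ℓ : ℝ → ℝ) (β : Fin d → ℝ) :
    regularizer M X ℓ ρ ε β = mahalanobisNorm M⁻¹ β *
      √(ρ * ∫ x, deriv ℓ (β ⬝ᵥ x) ^ 2 ∂(empiricalMeasure X)) := by
  rw [regularizer, iInf_eq_of_isMinOn (isMinOn_regularizerObjective_zero hN _ hε h),
    integral_empiricalMeasure, smul_eq_mul, ← mul_assoc, Real.sqrt_mul (by positivity),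
    ← div_eq_mul_inv]
  simp [regularizerObjective, gradVec]

end Value

theorem theorem5 {N d : ℕ} (hN : 0 < N) (M : Matrix (Fin d) (Fin d) ℝ) (hM : M.PosDef)
    (X : Fin N → Fin d → ℝ) (ρ ε : ℝ) (hρ : 0 ≤ ρ) (hε : 0 ≤ ε)
    (ℓ : ℝ → ℝ) (γ : ℝ) (hγ : 0 < γ) (hℓ : ContDiff ℝ 2 ℓ) (hℓγ : ∀ t, deriv (deriv ℓ) t = γ)
    (β : Fin d → ℝ) :
    -- the expectations in the model are well defined on every feasible coupling
    (∀ π ∈ perturbedMartingaleCouplings M X ρ ε,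
      Integrable Prod.fst π ∧ Integrable (fun p => ℓ (β ⬝ᵥ p.1)) π) ∧
    -- the minimum in the regularizer is attained
    (∃ s, IsMinOn (regularizerObjective (gradVec X ℓ β) ρ ε) Set.univ s) ∧
    -- the reformulation of the worst-case loss
    perturbedMartingaleDRO M X ℓ (fun x => β ⬝ᵥ x) ρ ε =
      ((∫ x, ℓ (β ⬝ᵥ x) ∂(empiricalMeasure X) + γ * ρ * mahalanobisNorm M⁻¹ β ^ 2 / 2 +
        regularizer M X ℓ ρ ε β : ℝ) : EReal) ∧
    -- no violation allowed: Tikhonov regularization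
    (ε = 0 → regularizer M X ℓ ρ ε β = 0 ∧
      perturbedMartingaleDRO M X ℓ (fun x => β ⬝ᵥ x) ρ ε =
        ((∫ x, ℓ (β ⬝ᵥ x) ∂(empiricalMeasure X) +
          γ * ρ * mahalanobisNorm M⁻¹ β ^ 2 / 2 : ℝ) : EReal)) ∧
    -- large violations allowed: square-root regularized regression (`m` is the minimum of the loss)
    (N * ρ ≤ ε ^ 2 →
      regularizer M X ℓ ρ ε β = √(ρ * ∫ x, mahalanobisNorm M⁻¹ (deriv ℓ (β ⬝ᵥ x) • β) ^ 2
        ∂(empiricalMeasure X)) ∧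
      ∀ m, IsLeast (Set.range ℓ) m →
        perturbedMartingaleDRO M X ℓ (fun x => β ⬝ᵥ x) ρ ε =
          ((m + (√(∫ x, ℓ (β ⬝ᵥ x) ∂(empiricalMeasure X) - m) +
            √(γ * ρ / 2) * mahalanobisNorm M⁻¹ β) ^ 2 : ℝ) : EReal)) := by
  have hval := perturbedMartingaleDRO_eq hN hM X hρ hε hγ.le hℓ hℓγ β
  obtain ⟨-, s, -, -, -, -, hs⟩ :=
    exists_isMinOn_regularizerObjective hN (gradVec X ℓ β) hρ hε
  refine ⟨fun π hπ => ?_, ⟨s, hs⟩, hval, ?_, fun h => ?_⟩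
  · have hprob : IsProbabilityMeasure π := hπ.1
    exact ⟨integrable_fst hN hM hπ.2.1 hπ.2.2.1, integrable_loss hN hM hπ hℓ hℓγ β⟩
  · rintro rfl
    rw [regularizer_eq_zero, add_zero] at hval
    exact ⟨regularizer_eq_zero X ρ ℓ β, hval⟩
  have hn0 := mahalanobisNorm_nonneg M⁻¹ β
  have hR := regularizer_eq_mul_sqrt (M := M) hN X hρ hε h ℓ β
  refine ⟨?_, fun m hm => ?_⟩
  · simp only [mahalanobisNorm_smul, mul_pow, sq_abs]
    rw [hR, integral_mul_const, ← mul_assoc, Real.sqrt_mul' _ (sq_nonneg _), Real.sqrt_sq hn0,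
      mul_comm]
  · have hmean : 0 ≤ ∫ x, ℓ (β ⬝ᵥ x) ∂(empiricalMeasure X) - m := by
      have := isProbabilityMeasure_empiricalMeasure hN X
      have hle := integral_mono (integrable_const m)
        (integrable_empiricalMeasure hN X fun x => ℓ (β ⬝ᵥ x)) fun x => hm.2 ⟨β ⬝ᵥ x, rfl⟩
      simpa using hle
    have hgrad : ∫ x, deriv ℓ (β ⬝ᵥ x) ^ 2 ∂(empiricalMeasure X) =
        2 * γ * (∫ x, ℓ (β ⬝ᵥ x) ∂(empiricalMeasure X) - m) := by
      have := isProbabilityMeasure_empiricalMeasure hN X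
      simp only [deriv_sq_of_isLeast hℓ hℓγ hm]
      rw [integral_const_mul, integral_sub (integrable_empiricalMeasure hN X _)
        (integrable_const m)]
      simp
    -- Times `‖β‖_{M⁻¹}`, this is the cross term of the square; the excess loss and the Tikhonov
    -- term are its two squares.
    have hroot : √(ρ * (2 * γ * (∫ x, ℓ (β ⬝ᵥ x) ∂(empiricalMeasure X) - m))) =
        2 * (√(∫ x, ℓ (β ⬝ᵥ x) ∂(empiricalMeasure X) - m) * √(γ * ρ / 2)) := by
      rw [← Real.sqrt_mul hmean, ← Real.sqrt_sq (zero_le_two (α := ℝ)),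
        ← Real.sqrt_mul (by positivity), Real.sqrt_sq (zero_le_two (α := ℝ))]
      congr 1
      ring
    rw [hval, hR, hgrad, hroot, add_sq, mul_pow, Real.sq_sqrt hmean,
      Real.sq_sqrt (by positivity)]
    congr 1
    ring
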